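/- Conventions. An ordered vector space is a real vector space with a partial order compatible with addition and with multiplication by nonnegative reals; a linear subspace carries the induced order. It is Archimedean if $nx\le y$ for all $n\in\mathbb N$ implies $x\le 0$. A linear subspace $D$ of an ordered vector space $E$ is majorizing in $E$ if every $x\in E$ satisfies $x\le d$ for some $d\in D$, and order dense in $E$ if $x=\inf\{z\in D: x\le z\}$ for every $x\in E$. For $x,y\in E$ write $x\perp y$ if $\{x+y,-(x+y)\}$ and $\{x-y,-(x-y)\}$ have the same upper bounds in $E$; for $M\subseteq E$ put $M^{\mathrm d}=\{x\in E: x\perp y\text{ for all }y\in M\}$. A linear subspace $B$ is a band in $E$ if $B^{\mathrm{dd}}=B$. A vector lattice cover of an ordered vector space $X$ is a pair $(Y,i)$, where $Y$ is a vector lattice and $i\colon X\to Y$ is a linear map with $i(x)\ge 0\iff x\ge 0$ whose image $i(X)$ is order dense in $Y$. If such a cover exists, $X$ is called a pre-Riesz space. A Dedekind completion of $X$ is a vector lattice cover $(Y,i)$ for which $Y$ is Dedekind complete, i.e. every non-empty subset of $Y$ that is bounded above has a supremum; for Archimedean pre-Riesz $X$ it is unique up to isomorphism and denoted $X^\delta$.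 A pre-Riesz space $X$ is pervasive if for every vector lattice cover $(Y,i)$ of $X$ and every $0<y\in Y$ there is $x\in X$ with $0<i(x)\le y$. If $(Y,i)$ is a vector lattice cover of $X$ and $B$ is a band in $X$, an extension band of $B$ in $Y$ is a band $J$ in $Y$ with $\{x\in X: i(x)\in J\}=B$; the smallest extension band $\hat B$ of $B$ in $Y$ is the intersection of all extension bands of $B$ in $Y$. Corollary. Let $X$ be an Archimedean pervasive pre-Riesz space with Dedekind completion $(X^\delta,i)$, let $B$ be a band in $X$, let $\hat B$ be the smallest extension band of $B$ in $X^\delta$, and suppose that $i(B)$ is majorizing in $\hat B$. Then $(\hat B,i|_B)$ is the Dedekind completion of $B$, and $B$ is a pervasive pre-Riesz space. -/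

import Mathlib

universe u v

namespace OrderedVectorSpace

/-! A (partially) ordered real vector space is a real vector space `E` with a partial order that is
compatible with addition (`IsOrderedAddMonoid E`) and with multiplication by nonnegative scalars
(`PosSMulMono ℝ E`). A linear subspace `D` of `E` carries the induced order on the type `↥D`. -/

section Space

variable (E : Type u) [AddCommGroup E] [PartialOrder E]

/-- `E` is Archimedean: if `n x ≤ y` for every natural number `n`, then `x ≤ 0`. -/
def IsArchimedean : Prop :=
  ∀ x y : E, (∀ n : ℕ, n • x ≤ y) → x ≤ 0

/-- The ordered vector space `E` is a vector lattice: any two elements have a supremum and an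
infimum. -/
def IsVectorLattice : Prop :=
  ∀ x y : E, (∃ z, IsLUB {x, y} z) ∧ (∃ z, IsGLB {x, y} z)

/-- Every non-empty subset of `E` that is bounded above has a supremum. -/
def IsDedekindComplete : Prop :=
  ∀ S : Set E, S.Nonempty → BddAbove S → ∃ z, IsLUB S z

end Space

section Disjointness

variable {E : Type u} [AddCommGroup E] [PartialOrder E]

/-- `x ⊥ y` in an ordered vector space: the sets `{x + y, -(x + y)}` and `{x - y, -(x - y)}` have the
same upper bounds. -/
def IsDisjoint (x y : E) : Prop :=
  upperBounds {x + y, -(x + y)} = upperBounds {x - y, -(x - y)}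

/-- The disjoint complement of a set. -/
def disjointComplement (M : Set E) : Set E :=
  {x | ∀ y ∈ M, IsDisjoint x y}

variable [Module ℝ E]

/-- A linear subspace `B` is a band if it equals its double disjoint complement. -/
def IsBand (B : Submodule ℝ E) : Prop :=
  disjointComplement (disjointComplement (B : Set E)) = (B : Set E)

/-- `D` is majorizing in `E`. -/
def IsMajorizing (D : Submodule ℝ E) : Prop :=
  ∀ x : E, ∃ d ∈ D, x ≤ d

/-- `D` is order dense in `E`: every `x` is the infimum of the elements of `D` above `x`. -/
def IsOrderDense (D : Submodule ℝ E) : Prop :=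
  ∀ x : E, IsGLB {z | z ∈ D ∧ x ≤ z} x

end Disjointness

section Maps

variable {X : Type u} [AddCommGroup X] [PartialOrder X] [Module ℝ X]
  {Y : Type v} [AddCommGroup Y] [PartialOrder Y] [Module ℝ Y]

/-- A linear map `i` is bipositive if `i x ≥ 0` holds exactly when `x ≥ 0`. -/
def IsBipositive (i : X →ₗ[ℝ] Y) : Prop :=
  ∀ x : X, 0 ≤ i x ↔ 0 ≤ x

/-- `(Y, i)` is a vector lattice cover of `X`. -/
structure IsVectorLatticeCover (i : X →ₗ[ℝ] Y) : Prop where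
  isVectorLattice : IsVectorLattice Y
  isBipositive : IsBipositive i
  isOrderDense : IsOrderDense (LinearMap.range i)

/-- `(Y, i)` is a Dedekind completion of `X`: a Dedekind complete vector lattice into which `X` is
embedded, by a bipositive linear map `i`, as an order dense subspace. -/
structure IsDedekindCompletion (i : X →ₗ[ℝ] Y) : Prop extends IsVectorLatticeCover i where
  isDedekindComplete : IsDedekindComplete Y

/-- `X` is pervasive in `(Y, i)`: below every `y > 0` of `Y` there is some `i x > 0` with `x ∈ X`. -/
def IsPervasiveIn (i : X →ₗ[ℝ] Y) : Prop :=
  ∀ y : Y, 0 < y → ∃ x : X, 0 < i x ∧ i x ≤ y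

/-- `J` is an extension band in `Y` of the linear subspace `B` of `X`: `J` is a band and
`{x ∈ X | i x ∈ J} = B`. -/
def IsExtensionBand (i : X →ₗ[ℝ] Y) (B : Submodule ℝ X) (J : Submodule ℝ Y) : Prop :=
  IsBand J ∧ J.comap i = B

/-- The smallest extension band of `B` in `Y`: the intersection of all extension bands of `B`. -/
def smallestExtensionBand (i : X →ₗ[ℝ] Y) (B : Submodule ℝ X) : Submodule ℝ Y :=
  sInf {J | IsExtensionBand i B J}

set_option linter.unusedSectionVars false in
theorem map_mem_smallestExtensionBand (i : X →ₗ[ℝ] Y) (B : Submodule ℝ X) (b : X) (hb : b ∈ B) :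
    i b ∈ smallestExtensionBand i B := by
  refine Submodule.mem_sInf.2 fun J hJ => ?_
  have h : b ∈ J.comap i := hJ.2.symm ▸ hb
  exact h

/-- The restriction `i|_B`, as a linear map from `B` to the smallest extension band of `B`. -/
def restrictToExtension (i : X →ₗ[ℝ] Y) (B : Submodule ℝ X) :
    B →ₗ[ℝ] smallestExtensionBand i B :=
  i.restrict (map_mem_smallestExtensionBand i B)

end Maps

section PreRiesz

variable (X : Type u) [AddCommGroup X] [PartialOrder X] [Module ℝ X]

/-- `X` is a pre-Riesz space: it has a vector lattice cover. -/
def IsPreRiesz : Prop :=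
  ∃ (Y : Type u) (_ : AddCommGroup Y) (_ : PartialOrder Y) (_ : IsOrderedAddMonoid Y)
    (_ : Module ℝ Y) (_ : PosSMulMono ℝ Y) (i : X →ₗ[ℝ] Y), IsVectorLatticeCover i

/-- `X` is a pervasive pre-Riesz space: it is a pre-Riesz space, and it is pervasive in its vector
lattice covers. -/
def IsPervasive : Prop :=
  IsPreRiesz X ∧
    ∀ (Y : Type u) [AddCommGroup Y] [PartialOrder Y] [IsOrderedAddMonoid Y]
      [Module ℝ Y] [PosSMulMono ℝ Y] (i : X →ₗ[ℝ] Y),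
      IsVectorLatticeCover i → IsPervasiveIn i

end PreRiesz

end OrderedVectorSpace

open OrderedVectorSpace

namespace OrderedVectorSpace

set_option linter.unusedSectionVars false

/-! ### Disjointness in vector lattices. -/

section Lattice

variable {E : Type*} [AddCommGroup E] [Lattice E] [IsOrderedAddMonoid E]

/-! The smallest extension band `J` of `B` is the double disjoint complement of `i '' B`, and it is
an extension band itself. Bands in a vector lattice are order convex, so `J` inherits lattice
structure and Dedekind completeness, and an element `i a` with `0 < i a ≤ y ∈ J` has `a ∈ B`:
pervasiveness passes to `B` in `J`. In a Dedekind complete lattice pervasiveness makes each positive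
element the supremum of the positive image elements below it (`IsPervasiveIn.isLUB_of_nonneg`);
reflecting `x` in a majorant `i b` turns this into order density. Finally,
`isPervasiveIn_of_isDedekindCompletion` carries pervasiveness from the completion to every cover of
`B`. -/

theorem abs_add_sup_abs_sub (x y : E) : |x + y| ⊔ |x - y| = |x| + |y| := by
  apply le_antisymm
  · exact sup_le (abs_add_le x y) (by simpa [sub_eq_add_neg] using abs_add_le x (-y))
  · have key : ∀ t : E, x + y ≤ t → x - y ≤ t → -(x + y) ≤ t → -(x - y) ≤ t → |x| + |y| ≤ t := by
      intro t h1 h2 h3 h4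
      have h : |y| ≤ t - |x| := by
        have hx1 : |x| ≤ t - y := abs_le'.2 ⟨le_sub_iff_add_le.2 h1,
          le_sub_iff_add_le.2 (by simpa [sub_eq_add_neg, add_comm] using h4)⟩
        have hx2 : |x| ≤ t + y := abs_le'.2 ⟨sub_le_iff_le_add.1 h2,
          sub_le_iff_le_add.1 (by simpa [sub_eq_add_neg, add_comm] using h3)⟩
        exact abs_le'.2 ⟨le_sub_comm.1 hx1, neg_le_sub_iff_le_add.2 (by simpa [add_comm] using hx2)⟩
      rw [add_comm]
      exact le_sub_iff_add_le.1 h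
    exact key _ ((le_abs_self _).trans le_sup_left) ((le_abs_self _).trans le_sup_right)
      ((neg_le_abs _).trans le_sup_left) ((neg_le_abs _).trans le_sup_right)

theorem isDisjoint_iff_abs_add_eq (x y : E) : IsDisjoint x y ↔ |x + y| = |x - y| := by
  have key : ∀ a : E, upperBounds {a, -a} = Set.Ici |a| := by
    intro a
    ext t
    simp [upperBounds_insert, abs_le']
  rw [IsDisjoint, key, key, Set.Ici_inj]

theorem abs_add_self (x : E) : |x + x| = |x| + |x| := by
  have h := abs_add_sup_abs_sub x x
  rwa [sub_self, abs_zero, sup_eq_left.2 (abs_nonneg _)] at h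

/-- Forward, `abs_add_sup_abs_sub` is used twice, for `x, y` and for `x + y, x - y`: the supremum of
`2|x|` and `2|y|` equals their sum, so their infimum vanishes. -/
theorem isDisjoint_iff_inf_abs_eq_zero (x y : E) : IsDisjoint x y ↔ |x| ⊓ |y| = 0 := by
  rw [isDisjoint_iff_abs_add_eq]
  constructor
  · intro h
    have h1 : |x + y| = |x| + |y| := by
      rw [← abs_add_sup_abs_sub, ← h, sup_idem]
    have h2 := abs_add_sup_abs_sub (x + y) (x - y)
    have e1 : x + y + (x - y) = x + x := by abel
    have e2 : x + y - (x - y) = y + y := by abel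
    rw [← h, e1, e2, h1, abs_add_self, abs_add_self] at h2
    have h3 : (|x| + |x|) ⊓ (|y| + |y|) = 0 := by
      have h4 := inf_add_sup (|x| + |x|) (|y| + |y|)
      rw [h2, add_add_add_comm |x| |y| |x| |y|] at h4
      exact add_eq_right.1 h4
    apply le_antisymm
    · rw [← h3]
      exact inf_le_inf (le_add_of_nonneg_left (abs_nonneg x)) (le_add_of_nonneg_left (abs_nonneg y))
    · exact le_inf (abs_nonneg x) (abs_nonneg y)
  · have key : ∀ y : E, |x| ⊓ |y| = 0 → |x + y| = |x| + |y| := by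
      intro y h
      apply le_antisymm (abs_add_le x y)
      have h1 : |x| ⊔ |y| = |x| + |y| := by
        rw [← inf_add_sup |x| |y|, h, zero_add]
      have h2 : |x| ⊔ |y| - |x| ⊓ |y| = |(|y| - |x|)| := sup_sub_inf_eq_abs_sub _ _
      rw [h, sub_zero, h1, abs_sub_comm] at h2
      rw [h2]
      have e : ∀ a b : E, |a| - |b| ≤ |a + b| := by
        intro a b
        rw [sub_le_iff_le_add]
        calc |a| = |(a + b) + -b| := by congr 1; abel
          _ ≤ |a + b| + |b| := by simpa using abs_add_le (a + b) (-b)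
      exact abs_le'.2 ⟨e x y, by rw [neg_sub, add_comm]; exact e y x⟩
    intro h
    rw [key y h, sub_eq_add_neg, key (-y) (by rwa [abs_neg]), abs_neg]

theorem mem_disjointComplement_of_abs_le {M : Set E} {x y : E}
    (hx : x ∈ disjointComplement M) (h : |y| ≤ |x|) : y ∈ disjointComplement M := by
  intro z hz
  rw [isDisjoint_iff_inf_abs_eq_zero]
  apply le_antisymm
  · rw [← (isDisjoint_iff_inf_abs_eq_zero x z).1 (hx z hz)]
    exact inf_le_inf_right _ h
  · exact le_inf (abs_nonneg y) (abs_nonneg z)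

theorem add_mem_disjointComplement {M : Set E} {x y : E}
    (hx : x ∈ disjointComplement M) (hy : y ∈ disjointComplement M) :
    x + y ∈ disjointComplement M := by
  intro z hz
  have h1 := (isDisjoint_iff_inf_abs_eq_zero x z).1 (hx z hz)
  have h2 := (isDisjoint_iff_inf_abs_eq_zero y z).1 (hy z hz)
  rw [isDisjoint_iff_inf_abs_eq_zero]
  apply le_antisymm _ (le_inf (abs_nonneg _) (abs_nonneg z))
  rw [← h2]
  refine le_inf ?_ inf_le_right
  -- Subtracting `|y|` from `|x + y| ⊓ |z|` leaves something below `|x| ⊓ |z| = 0`.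
  rw [← sub_nonpos, ← h1]
  refine le_inf ?_ ?_
  · rw [sub_le_iff_le_add]
    exact inf_le_left.trans (abs_add_le x y)
  · exact (sub_le_self _ (abs_nonneg y)).trans inf_le_right

variable [Module ℝ E] [PosSMulMono ℝ E]

theorem abs_smul_le_nsmul_abs (r : ℝ) (n : ℕ) (hr : |r| ≤ n) (x : E) : |r • x| ≤ n • |x| := by
  have key : ∀ r : ℝ, |r| ≤ n → r • x ≤ n • |x| := by
    intro r hr
    obtain ⟨h1, h2⟩ := abs_le.1 hr
    -- Both coefficients are nonnegative because `|r| ≤ n`.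
    have e : n • |x| - r • x =
        (((n : ℝ) - r) / 2) • (|x| + x) + (((n : ℝ) + r) / 2) • (|x| - x) := by
      rw [← Nat.cast_smul_eq_nsmul ℝ]
      module
    rw [← sub_nonneg, e]
    refine add_nonneg (smul_nonneg (by linarith) ?_) (smul_nonneg (by linarith) ?_)
    · exact neg_le_iff_add_nonneg.1 (neg_le_abs x)
    · exact sub_nonneg.2 (le_abs_self x)
  refine abs_le'.2 ⟨key r hr, ?_⟩
  rw [← neg_smul]
  exact key (-r) (by rwa [abs_neg])

/-- In a vector lattice, disjoint complements are linear subspaces. -/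
def disjointComplementSubmodule (M : Set E) : Submodule ℝ E where
  carrier := disjointComplement M
  add_mem' := add_mem_disjointComplement
  zero_mem' := fun z _ => by simp [IsDisjoint, Set.pair_comm]
  smul_mem' := fun r x hx => by
    obtain ⟨n, hn⟩ := exists_nat_ge |r|
    have hn' : n • |x| ∈ disjointComplement M := by
      clear hn
      induction n with
      | zero => intro z _; simp [IsDisjoint, Set.pair_comm]
      | succ n ih =>
        rw [succ_nsmul]
        exact add_mem_disjointComplement ih
          (mem_disjointComplement_of_abs_le hx (abs_abs x).le)
    exact mem_disjointComplement_of_abs_le hn'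
      ((abs_smul_le_nsmul_abs r n hn x).trans (abs_of_nonneg (nsmul_nonneg (abs_nonneg x) n)).ge)

end Lattice

/-! ### Bands in vector lattices. -/

section Band

variable {E : Type*} [AddCommGroup E]

theorem IsDisjoint.symm [PartialOrder E] {x y : E} (h : IsDisjoint x y) : IsDisjoint y x := by
  unfold IsDisjoint at *
  rw [add_comm y x, h, neg_sub, neg_sub, Set.pair_comm]

theorem subset_disjointComplement_disjointComplement [PartialOrder E] (M : Set E) :
    M ⊆ disjointComplement (disjointComplement M) :=
  fun x hx _ hy => (hy x hx).symm

theorem disjointComplement_anti [PartialOrder E] {M N : Set E} (h : M ⊆ N) :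
    disjointComplement N ⊆ disjointComplement M :=
  fun _ hx y hy => hx y (h hy)

theorem disjointComplement_triple [PartialOrder E] (M : Set E) :
    disjointComplement (disjointComplement (disjointComplement M)) = disjointComplement M :=
  (disjointComplement_anti (subset_disjointComplement_disjointComplement M)).antisymm
    (subset_disjointComplement_disjointComplement _)

/-- The lattice is built on the given order itself, so `obtain ⟨L, rfl⟩` makes the absolute value
lemmas available for notions defined from the order alone. -/
theorem IsVectorLattice.exists_lattice [P : PartialOrder E] (h : IsVectorLattice E) :
    ∃ L : Lattice E, L.toPartialOrder = P := by
  choose hs hi using h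
  choose s hs using hs
  choose t ht using hi
  exact ⟨{ P with
    sup := s
    inf := t
    le_sup_left := fun a b => (hs a b).1 (by simp)
    le_sup_right := fun a b => (hs a b).1 (by simp)
    sup_le := fun a b c h1 h2 => (hs a b).2 (by simp [upperBounds_insert, h1, h2])
    inf_le_left := fun a b => (ht a b).1 (by simp)
    inf_le_right := fun a b => (ht a b).1 (by simp)
    le_inf := fun a b c h1 h2 => (ht b c).2 (by simp [lowerBounds_insert, h1, h2]) }, rfl⟩

variable [P : PartialOrder E] [IsOrderedAddMonoid E] [Module ℝ E]

theorem exists_submodule_eq_disjointComplement [PosSMulMono ℝ E] (h : IsVectorLattice E)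
    (M : Set E) : ∃ D : Submodule ℝ E, (D : Set E) = disjointComplement M := by
  obtain ⟨L, rfl⟩ := h.exists_lattice
  exact ⟨disjointComplementSubmodule M, rfl⟩

theorem IsBand.mem_of_le_of_le (h : IsVectorLattice E) {K : Submodule ℝ E} (hK : IsBand K)
    {a b c : E} (ha : a ∈ K) (hc : c ∈ K) (hab : a ≤ b) (hbc : b ≤ c) : b ∈ K := by
  obtain ⟨L, rfl⟩ := h.exists_lattice
  have hca : c - a ∈ disjointComplement (disjointComplement (K : Set E)) := by
    rw [hK]
    exact K.sub_mem hc ha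
  have hba : b - a ∈ (K : Set E) := by
    rw [← hK]
    refine mem_disjointComplement_of_abs_le hca ?_
    rw [abs_of_nonneg (sub_nonneg.2 hab), abs_of_nonneg (sub_nonneg.2 (hab.trans hbc))]
    exact sub_le_sub_right hbc a
  simpa using K.add_mem hba ha

theorem IsBand.exists_mem_ge (h : IsVectorLattice E) {K : Submodule ℝ E} (hK : IsBand K)
    {x : E} (hx : x ∈ K) : ∃ u ∈ K, 0 ≤ u ∧ x ≤ u ∧ -x ≤ u := by
  obtain ⟨L, rfl⟩ := h.exists_lattice
  refine ⟨|x|, ?_, abs_nonneg x, le_abs_self x, neg_le_abs x⟩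
  rw [← SetLike.mem_coe, ← hK] at hx ⊢
  exact mem_disjointComplement_of_abs_le hx (abs_abs x).le

theorem IsBand.isVectorLattice (h : IsVectorLattice E) {K : Submodule ℝ E} (hK : IsBand K) :
    IsVectorLattice K := by
  intro x y
  -- With `u ≥ ±(y - x)`, the supremum lies in `[x, x + u]` and the infimum in `[x - u, x]`, so
  -- convexity puts both in `K`.
  obtain ⟨u, hu, hu0, h1, h2⟩ := hK.exists_mem_ge h (K.sub_mem y.2 x.2)
  rw [neg_sub] at h2
  obtain ⟨⟨s, hs⟩, ⟨t, ht⟩⟩ := h (x : E) y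
  have hsK : s ∈ K := by
    refine hK.mem_of_le_of_le h x.2 (K.add_mem x.2 hu) (hs.1 (by simp)) (hs.2 ?_)
    simp only [upperBounds_insert, upperBounds_singleton]
    exact ⟨le_add_of_nonneg_right hu0, sub_le_iff_le_add'.1 h1⟩
  have htK : t ∈ K := by
    refine hK.mem_of_le_of_le h (K.sub_mem x.2 hu) x.2 (ht.2 ?_) (ht.1 (by simp))
    simp only [lowerBounds_insert, lowerBounds_singleton]
    exact ⟨sub_le_self _ hu0, sub_le_comm.1 h2⟩
  refine ⟨⟨⟨s, hsK⟩, ?_, ?_⟩, ⟨⟨t, htK⟩, ?_, ?_⟩⟩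
  · rintro z (rfl | rfl)
    exacts [hs.1 (by simp), hs.1 (by simp)]
  · intro z hz
    refine hs.2 ?_
    rintro w (rfl | rfl)
    exacts [hz (by simp), hz (by simp)]
  · rintro z (rfl | rfl)
    exacts [ht.1 (by simp), ht.1 (by simp)]
  · intro z hz
    refine ht.2 ?_
    rintro w (rfl | rfl)
    exacts [hz (by simp), hz (by simp)]

theorem IsBand.isDedekindComplete (h : IsVectorLattice E) (hE : IsDedekindComplete E)
    {K : Submodule ℝ E} (hK : IsBand K) : IsDedekindComplete K := by
  rintro S ⟨x, hx⟩ ⟨b, hb⟩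
  have hbE : (b : E) ∈ upperBounds ((↑) '' S) := by
    rintro _ ⟨y, hy, rfl⟩
    exact hb hy
  obtain ⟨s, hs⟩ := hE ((↑) '' S) ⟨x, x, hx, rfl⟩ ⟨b, hbE⟩
  have hsK : s ∈ K := hK.mem_of_le_of_le h x.2 b.2 (hs.1 ⟨x, hx, rfl⟩) (hs.2 hbE)
  refine ⟨⟨s, hsK⟩, fun y hy => hs.1 ⟨y, hy, rfl⟩, fun z hz => hs.2 ?_⟩
  rintro _ ⟨y, hy, rfl⟩
  exact hz hy

end Band

/-! ### Extension bands, order density and pervasiveness. -/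

section Maps

variable {X : Type*} [AddCommGroup X] [PartialOrder X] [IsOrderedAddMonoid X] [Module ℝ X]
  {Y : Type*} [AddCommGroup Y] [PartialOrder Y] [IsOrderedAddMonoid Y] [Module ℝ Y]
  {i : X →ₗ[ℝ] Y}

theorem IsBipositive.map_le_map_iff (hi : IsBipositive i) {x y : X} : i x ≤ i y ↔ x ≤ y := by
  rw [← sub_nonneg, ← map_sub, hi, sub_nonneg]

theorem IsBipositive.map_pos_iff (hi : IsBipositive i) {x : X} : 0 < i x ↔ 0 < x := by
  rw [lt_iff_le_not_ge, lt_iff_le_not_ge, ← map_zero i, hi.map_le_map_iff, hi.map_le_map_iff]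

theorem IsOrderDense.le_of_forall {D : Submodule ℝ Y} (hD : IsOrderDense D) {y z : Y}
    (h : ∀ d ∈ D, y ≤ d → z ≤ d) : z ≤ y :=
  (hD y).2 fun d hd => h d hd.1 hd.2

theorem IsOrderDense.le_of_forall_le {D : Submodule ℝ Y} (hD : IsOrderDense D) {y z : Y}
    (h : ∀ d ∈ D, d ≤ y → d ≤ z) : y ≤ z :=
  neg_le_neg_iff.1 (hD.le_of_forall fun d hd hyd =>
    neg_le.1 (h (-d) (D.neg_mem hd) (neg_le.1 hyd)))

theorem map_mem_upperBounds_pair_neg (hi : IsBipositive i) (u x : X) :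
    i u ∈ upperBounds {i x, -i x} ↔ u ∈ upperBounds {x, -x} := by
  simp only [upperBounds_insert, upperBounds_singleton, Set.mem_inter_iff, Set.mem_Ici, ← map_neg,
    hi.map_le_map_iff]

/-- By order density, an upper bound in `Y` is the infimum of the image elements above it, so upper
bounds coming from `X` decide. -/
theorem isDisjoint_map_iff (hi : IsBipositive i) (hd : IsOrderDense (LinearMap.range i)) (x y : X) :
    IsDisjoint (i x) (i y) ↔ IsDisjoint x y := by
  have mono : ∀ a b : X, upperBounds {a, -a} ⊆ upperBounds {b, -b} →
      upperBounds {i a, -i a} ⊆ upperBounds {i b, -i b} := by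
    intro a b h u hu c hc
    refine hd.le_of_forall ?_
    rintro _ ⟨v, rfl⟩ hv
    have hv' : i v ∈ upperBounds {i a, -i a} := fun w hw => (hu hw).trans hv
    exact (map_mem_upperBounds_pair_neg hi v b).2
      (h ((map_mem_upperBounds_pair_neg hi v a).1 hv')) hc
  unfold IsDisjoint
  rw [← map_add, ← map_sub]
  constructor
  · intro h
    ext u
    rw [← map_mem_upperBounds_pair_neg hi, ← map_mem_upperBounds_pair_neg hi, h]
  · intro h
    exact (mono _ _ h.le).antisymm (mono _ _ h.ge)

theorem isExtensionBand_of_coe_eq (hi : IsBipositive i) (hd : IsOrderDense (LinearMap.range i))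
    {B : Submodule ℝ X} (hB : IsBand B) {J : Submodule ℝ Y}
    (hJ : (J : Set Y) = disjointComplement (disjointComplement (i '' B))) :
    IsExtensionBand i B J := by
  refine ⟨?_, le_antisymm ?_ ?_⟩
  · unfold IsBand
    rw [hJ, disjointComplement_triple]
  · intro x hx
    have hx' : i x ∈ (J : Set Y) := hx
    rw [hJ] at hx'
    rw [← SetLike.mem_coe, ← hB]
    intro y hy
    rw [← isDisjoint_map_iff hi hd]
    refine hx' _ ?_
    rintro _ ⟨b, hb, rfl⟩
    exact (isDisjoint_map_iff hi hd y b).2 (hy b hb)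
  · intro x hx
    change i x ∈ (J : Set Y)
    rw [hJ]
    exact subset_disjointComplement_disjointComplement _ ⟨x, hx, rfl⟩

theorem IsVectorLatticeCover.isExtensionBand_smallestExtensionBand [PosSMulMono ℝ Y]
    (hY : IsVectorLatticeCover i) {B : Submodule ℝ X} (hB : IsBand B) :
    IsExtensionBand i B (smallestExtensionBand i B) := by
  obtain ⟨J, hJ⟩ := exists_submodule_eq_disjointComplement hY.isVectorLattice
    (disjointComplement (i '' B))
  have hext := isExtensionBand_of_coe_eq hY.isBipositive hY.isOrderDense hB hJ
  have hle : smallestExtensionBand i B = J := by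
    refine le_antisymm (sInf_le hext) (le_sInf fun K hK => ?_)
    have himage : i '' (B : Set X) ⊆ K := by
      rintro _ ⟨b, hb, rfl⟩
      exact hK.2.ge hb
    rw [← SetLike.coe_subset_coe, hJ, ← hK.1]
    exact disjointComplement_anti (disjointComplement_anti himage)
  rwa [hle]

theorem IsPervasiveIn.isLUB_of_nonneg (hY : IsDedekindComplete Y) (hp : IsPervasiveIn i) {y : Y}
    (hy : 0 ≤ y) : IsLUB {z | ∃ a : X, i a = z ∧ 0 ≤ i a ∧ i a ≤ y} y := by
  set S : Set Y := {z | ∃ a : X, i a = z ∧ 0 ≤ i a ∧ i a ≤ y}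
  have hub : y ∈ upperBounds S := by
    rintro _ ⟨a, rfl, -, h⟩
    exact h
  obtain ⟨s, hs⟩ := hY S ⟨0, 0, by simp, by simp, by simpa using hy⟩ ⟨y, hub⟩
  obtain h | h := (hs.2 hub).eq_or_lt
  · rwa [h] at hs
  · obtain ⟨a, ha0, ha⟩ := hp (y - s) (sub_pos.2 h)
    -- Adding `a` to a member of `S` gives a member of `S` again, because `i a` fits into the gap `y
    -- - s`.
    have hle : s ≤ s - i a := by
      refine hs.2 ?_
      rintro _ ⟨c, rfl, hc0, hc⟩
      rw [le_sub_iff_add_le]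
      refine hs.1 ⟨c + a, map_add i c a, ?_, ?_⟩
      · rw [map_add]
        exact add_nonneg hc0 ha0.le
      · rw [map_add]
        calc i c + i a ≤ s + (y - s) := add_le_add (hs.1 ⟨c, rfl, hc0, hc⟩) ha
          _ = y := add_sub_cancel s y
    exact absurd hle (sub_lt_self s ha0).not_ge

theorem IsExtensionBand.isPervasiveIn_restrict (h : IsVectorLattice Y) (hp : IsPervasiveIn i)
    {B : Submodule ℝ X} (hJ : IsExtensionBand i B (smallestExtensionBand i B)) :
    IsPervasiveIn (restrictToExtension i B) := by
  intro y hy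
  obtain ⟨a, ha0, ha⟩ := hp y hy
  have haB : a ∈ B := hJ.2.le (hJ.1.mem_of_le_of_le h (Submodule.zero_mem _) y.2 ha0.le ha)
  exact ⟨⟨a, haB⟩, ha0, ha⟩

theorem isOrderDense_range_of_isMajorizing (hY : IsDedekindComplete Y) (hp : IsPervasiveIn i)
    (hMaj : IsMajorizing (LinearMap.range i)) : IsOrderDense (LinearMap.range i) := by
  refine fun x => ⟨fun z hz => hz.2, fun w hw => ?_⟩
  obtain ⟨_, ⟨b, rfl⟩, hb⟩ := hMaj x
  rw [← sub_le_sub_iff_left (i b)]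
  refine (hp.isLUB_of_nonneg hY (sub_nonneg.2 hb)).2 ?_
  rintro _ ⟨a, rfl, -, ha⟩
  refine le_sub_comm.1 (hw ⟨⟨b - a, map_sub i b a⟩, le_sub_comm.1 ha⟩)

theorem isPervasiveIn_of_isDedekindCompletion {Z : Type*} [AddCommGroup Z] [PartialOrder Z]
    [IsOrderedAddMonoid Z] [Module ℝ Z] {j : X →ₗ[ℝ] Z} (hY : IsDedekindCompletion i)
    (hp : IsPervasiveIn i) (hZ : IsVectorLatticeCover j) : IsPervasiveIn j := by
  intro z hz
  have hi := hY.isBipositive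
  have hj := hZ.isBipositive
  have hlow : ∃ b : X, j b ≤ z ∧ ¬ b ≤ 0 := by
    by_contra! h
    refine hz.not_ge (hZ.isOrderDense.le_of_forall_le ?_)
    rintro _ ⟨b, rfl⟩ hb
    rw [← map_zero j, hj.map_le_map_iff]
    exact h b hb
  obtain ⟨b, hbz, hb⟩ := hlow
  let U : Set X := {u | z ≤ j u}
  have hUlow : ∀ a : X, j a ≤ z → -i a ∈ upperBounds ((fun u => -i u) '' U) := by
    rintro a ha _ ⟨u, hu, rfl⟩
    exact neg_le_neg (hi.map_le_map_iff.2 (hj.map_le_map_iff.1 (ha.trans hu)))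
  have hne : U.Nonempty := by
    by_contra h
    -- If `U` is empty, order density at `z` is an infimum over the empty set, and any element lies
    -- below `z`.
    have hle : z + z ≤ z := by
      refine hZ.isOrderDense.le_of_forall ?_
      rintro _ ⟨u, rfl⟩ hu
      exact absurd ⟨u, hu⟩ h
    exact hle.not_gt (lt_add_of_pos_right z hz)
  -- Here `-s` is the infimum of `i '' U`, a stand-in for `z` in `Y`; it lies above `0` and above `i
  -- b`, and `¬ b ≤ 0` keeps it from being zero.
  obtain ⟨s, hs⟩ := hY.isDedekindComplete ((fun u => -i u) '' U) (hne.image _) ⟨_, hUlow b hbz⟩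
  have hs0 : s ≤ 0 := by
    have := hs.2 (hUlow 0 (by simpa using hz.le))
    simpa using this
  have hsne : s ≠ 0 := by
    rintro rfl
    have h0 : 0 ≤ i (-b) := by simpa using hs.2 (hUlow b hbz)
    exact hb (by simpa using (hi _).1 h0)
  obtain ⟨x, hx0, hx⟩ := hp (-s) (neg_pos.2 (lt_of_le_of_ne hs0 hsne))
  refine ⟨x, hj.map_pos_iff.2 (hi.map_pos_iff.1 hx0), hZ.isOrderDense.le_of_forall ?_⟩
  rintro _ ⟨u, rfl⟩ hu
  rw [hj.map_le_map_iff, ← hi.map_le_map_iff]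
  exact hx.trans (neg_le.1 (hs.1 ⟨u, hu, rfl⟩))

end Maps

end OrderedVectorSpace

theorem corollary4p7 {X : Type u} [AddCommGroup X] [PartialOrder X] [IsOrderedAddMonoid X]
    [Module ℝ X] [PosSMulMono ℝ X]
    (hArch : IsArchimedean X) (hPerv : IsPervasive X)
    -- `(Y, i)` is the Dedekind completion of `X`
    {Y : Type u} [AddCommGroup Y] [PartialOrder Y] [IsOrderedAddMonoid Y]
    [Module ℝ Y] [PosSMulMono ℝ Y] (i : X →ₗ[ℝ] Y) (hY : IsDedekindCompletion i)
    (B : Submodule ℝ X) (hB : IsBand B)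
    (hMaj : IsMajorizing (LinearMap.range (restrictToExtension i B))) :
    IsDedekindCompletion (restrictToExtension i B) ∧ IsPervasive B := by
  have hp : IsPervasiveIn i := hPerv.2 Y i hY.toIsVectorLatticeCover
  have hJ := hY.isExtensionBand_smallestExtensionBand hB
  have hdc := hJ.1.isDedekindComplete hY.isVectorLattice hY.isDedekindComplete
  have hpJ := hJ.isPervasiveIn_restrict hY.isVectorLattice hp
  have hcompl : IsDedekindCompletion (restrictToExtension i B) :=
    { isVectorLattice := hJ.1.isVectorLattice hY.isVectorLattice
      isBipositive := fun b => hY.isBipositive b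
      isOrderDense := isOrderDense_range_of_isMajorizing hdc hpJ hMaj
      isDedekindComplete := hdc }
  have : PosSMulMono ℝ (smallestExtensionBand i B) :=
    ⟨fun r hr _ _ h => smul_le_smul_of_nonneg_left (α := ℝ) (β := Y) h hr⟩
  refine ⟨hcompl, ⟨smallestExtensionBand i B, inferInstance, inferInstance, inferInstance,
    inferInstance, inferInstance, restrictToExtension i B, hcompl.toIsVectorLatticeCover⟩, ?_⟩
  intro Z _ _ _ _ _ j hj
  exact isPervasiveIn_of_isDedekindCompletion hcompl hpJ hj
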